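/- For $p>2$, $s>0$, a symmetric positive semidefinite matrix $A\in\mathbb R^{d\times d}$ and $b\in\mathbb R^d$, consider the regularized quadratic function $$f(x)=\tfrac12 x^\top A x-b^\top x+\tfrac{s}{p}\|x\|^p,\qquad x\in\mathbb R^d,$$ where $\|\cdot\|$ is the Euclidean norm, and write $f_\star=\min_{x\in\mathbb R^d}f(x)$ (the minimum is attained). A first-order method is a sequence of arbitrary mappings $\mathcal M=(\mathcal M_0,\mathcal M_1,\dots)$; applied to $f$ it produces the points $x_0=0$ and $$x_{k+1}=\mathcal M_k\bigl((f(x_0),\nabla f(x_0)),\dots,(f(x_k),\nabla f(x_k))\bigr),\qquad k\ge 0.$$ Theorem. There is an absolute constant $c>0$ such that the following holds. Let $p>2$, $s>0$, $L>0$, and let $d,N$ be integers with $1\le N\le \frac{d-1}{2}$. For every first-order method $\mathcal M$ on $\mathbb R^d$ there are a symmetric positive semidefinite matrix $A\in\mathbb R^{d\times d}$ with largest eigenvalue $\lambda_{\max}(A)=L$ and a vector $b\in\mathbb R^d$ such that, for the corresponding regularized quadratic $f$ with parameters $p$ and $s$, the point $x_N$ produced by $\mathcal M$ on $f$ satisfies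 both $$f(x_N)-f_\star\;\ge\; c\left[\frac{L}{s^{2/p}N^2}\right]^{\frac{p}{p-2}} \qquad\text{and}\qquad \|\nabla f(x_N)\|\;\ge\; c\left[\frac{L}{s^{1/(p-1)}N^2}\right]^{\frac{p-1}{p-2}}.$$ -/

import Mathlib

noncomputable section

namespace RegQuad

/-- `ℝ^d` with the standard Euclidean norm. -/
abbrev E (d : ℕ) : Type := EuclideanSpace ℝ (Fin d)

/-- The regularized quadratic `f(x) = ½ xᵀ A x - bᵀ x + (s / p) ‖x‖^p`. -/
def objective {d : ℕ} (p s : ℝ) (A : Matrix (Fin d) (Fin d) ℝ) (b : E d) (x : E d) : ℝ :=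
  1 / 2 * inner ℝ x (Matrix.toEuclideanLin A x) - inner ℝ b x + s / p * ‖x‖ ^ p

/-- `L` is the largest eigenvalue of `A`. -/
def IsMaxEigenvalue {d : ℕ} (A : Matrix (Fin d) (Fin d) ℝ) (L : ℝ) : Prop :=
  IsGreatest {l : ℝ | Module.End.HasEigenvalue (Matrix.toEuclideanLin A) l} L

/-- The first-order oracle: it answers a query `x` with the pair `(f x, ∇ f x)`. -/
def oracle {d : ℕ} (f : E d → ℝ) (x : E d) : ℝ × E d :=
  (f x, gradient f x)

/-- A (deterministic) first-order method: a sequence of arbitrary maps `M 0, M 1, …`, where `M k`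
computes the next point from the `k + 1` oracle answers collected so far. -/
abbrev FirstOrderMethod (d : ℕ) : Type :=
  (k : ℕ) → (Fin (k + 1) → ℝ × E d) → E d

/-- The iterates of the method `M` on `f`: `x₀ = 0` and
`x_{k+1} = M_k (oracle x₀, …, oracle x_k)`. -/
def iterate {d : ℕ} (M : FirstOrderMethod d) (f : E d → ℝ) : ℕ → E d
  | 0 => 0
  | k + 1 => M k (fun i : Fin (k + 1) => oracle f (iterate M f i.val))
termination_by n => n
decreasing_by exact i.isLt

theorem iterate_zero {d : ℕ} (M : FirstOrderMethod d) (f : E d → ℝ) : iterate M f 0 = 0 := by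
  rw [iterate]

theorem iterate_succ {d : ℕ} (M : FirstOrderMethod d) (f : E d → ℝ) (k : ℕ) :
    iterate M f (k + 1) = M k (fun i : Fin (k + 1) => oracle f (iterate M f i.val)) := by
  rw [iterate]

end RegQuad

end

/-!
The hard instances are `A = a ∑_{i < N} dᵢ dᵢᵀ` with `dᵢ = uᵢ - u_{i+1}`, a scaled path Laplacian on
a hidden orthonormal family `u 0, …, u N`, and `b` a multiple of `u 0`.

* **Resisting oracle** (`exists_resisting_family`). A query orthogonal to `u j, u (j + 1), …` has an
  answer involving only `u 0, …, u j`. Hence `u (k + 1)` may be chosen after the iterate `x (k + 1)`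
  is known, orthogonal to all previous `u`'s and iterates; `2 N + 1` dimensions suffice to make `x N`
  orthogonal to `u N`.
* **Choice of the minimizer.** Put `μ = L / N ^ 2` and `r = (μ / s) ^ (1 / (p - 2))`, so that
  `s r ^ (p - 2) = μ`; the two target quantities are then exactly `μ r ^ 2` and `μ r`. If
  `(A + μ) y = b` and `‖y‖ = r`, then `y` is a critical point of the regularized quadratic, hence
  its minimizer by convexity. The right-hand side `b` is free, so `y` is taken as a multiple of the
  explicit `profile`, which varies only by a bounded factor along the path
  (`profile_le_exp`, `OrthonormalUpTo.pathLaplacian_profile`). In particular its last coordinate is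
  at least a constant times `r / √(N + 1)`.
* **Energy.** Since `x N` is orthogonal to `u N`, the last coordinate of `x N - y` is that of `-y`,
  and a discrete Sobolev inequality (`OrthonormalUpTo.energy_ge`) bounds the quadratic form of
  `A + μ` at `x N - y` below by a constant times `μ r ^ 2`. The tangent inequality
  `objective_sub_ge`, which has the exact constant `1 / 2` for every `p > 2`, turns this into bounds
  for the objective gap and for the gradient (`gap_and_gradient_ge`) that are uniform in `p`.

The factor `a` is fixed by `λ_max(A) = L`. It is at least `L / 4` and can be chosen in advance, because
all path Laplacians of the same length have the same non-zero eigenvalues.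
-/

open scoped InnerProductSpace

namespace RegQuad

/-! ### The path Laplacian on an orthonormal family -/

section PathLaplacian

variable {F : Type*} [NormedAddCommGroup F] [InnerProductSpace ℝ F]

/-- The vectors `u 0, …, u n` are orthonormal. Families are indexed by `ℕ`, so that one more vector
can be revealed at a time; the values beyond `n` are irrelevant. -/
def OrthonormalUpTo (u : ℕ → F) (n : ℕ) : Prop :=
  ∀ i ≤ n, ∀ j ≤ n, ⟪u i, u j⟫_ℝ = if i = j then 1 else 0

/-- The operator `∑_{i < N} dᵢ dᵢᵀ` with `dᵢ = uᵢ - u_{i+1}`: on an orthonormal family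
`u 0, …, u N` it is the graph Laplacian of the path on these vectors, and it vanishes on their
orthogonal complement. -/
noncomputable def pathLaplacian (u : ℕ → F) (N : ℕ) : F →ₗ[ℝ] F :=
  ∑ i ∈ Finset.range N, (innerₛₗ ℝ (u i - u (i + 1))).smulRight (u i - u (i + 1))

theorem pathLaplacian_apply (u : ℕ → F) (N : ℕ) (x : F) :
    pathLaplacian u N x =
      ∑ i ∈ Finset.range N, ⟪u i - u (i + 1), x⟫_ℝ • (u i - u (i + 1)) := by
  simp only [pathLaplacian, LinearMap.sum_apply, LinearMap.smulRight_apply, innerₛₗ_apply_apply]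

theorem inner_pathLaplacian (u : ℕ → F) (N : ℕ) (x y : F) :
    ⟪x, pathLaplacian u N y⟫_ℝ =
      ∑ i ∈ Finset.range N, ⟪u i - u (i + 1), x⟫_ℝ * ⟪u i - u (i + 1), y⟫_ℝ := by
  rw [pathLaplacian_apply, inner_sum]
  refine Finset.sum_congr rfl fun i _ => ?_
  rw [real_inner_smul_right, real_inner_comm x, mul_comm]

theorem inner_pathLaplacian_self (u : ℕ → F) (N : ℕ) (x : F) :
    ⟪x, pathLaplacian u N x⟫_ℝ =
      ∑ i ∈ Finset.range N, (⟪u i, x⟫_ℝ - ⟪u (i + 1), x⟫_ℝ) ^ 2 := by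
  rw [inner_pathLaplacian]
  refine Finset.sum_congr rfl fun i _ => ?_
  rw [inner_sub_left, sq]

theorem isSymmetric_pathLaplacian (u : ℕ → F) (N : ℕ) : (pathLaplacian u N).IsSymmetric := by
  intro x y
  rw [real_inner_comm, inner_pathLaplacian, inner_pathLaplacian]
  exact Finset.sum_congr rfl fun i _ => mul_comm _ _

theorem inner_pathLaplacian_self_nonneg (u : ℕ → F) (N : ℕ) (x : F) :
    0 ≤ ⟪x, pathLaplacian u N x⟫_ℝ := by
  rw [inner_pathLaplacian_self]
  exact Finset.sum_nonneg fun i _ => sq_nonneg _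

theorem OrthonormalUpTo.inner_sum_smul {u : ℕ → F} {n : ℕ} (hu : OrthonormalUpTo u n)
    (c : ℕ → ℝ) {i : ℕ} (hi : i ≤ n) :
    ⟪u i, ∑ j ∈ Finset.range (n + 1), c j • u j⟫_ℝ = c i := by
  rw [inner_sum, Finset.sum_eq_single i]
  · rw [real_inner_smul_right, hu i hi i hi]; simp
  · intro j hj hji
    rw [real_inner_smul_right, hu i hi j (by simpa [Nat.lt_succ_iff] using hj)]
    simp [Ne.symm hji]
  · intro h; exact absurd (Finset.mem_range.2 (Nat.lt_succ_of_le hi)) h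

theorem OrthonormalUpTo.norm_sum_smul_sq {u : ℕ → F} {n : ℕ} (hu : OrthonormalUpTo u n)
    (c : ℕ → ℝ) :
    ‖∑ j ∈ Finset.range (n + 1), c j • u j‖ ^ 2 = ∑ j ∈ Finset.range (n + 1), c j ^ 2 := by
  rw [← real_inner_self_eq_norm_sq, sum_inner]
  refine Finset.sum_congr rfl fun i hi => ?_
  rw [real_inner_smul_left, hu.inner_sum_smul c (by simpa [Nat.lt_succ_iff] using hi), sq]

/-- Bessel's inequality. -/
theorem OrthonormalUpTo.sum_inner_sq_le {u : ℕ → F} {n : ℕ} (hu : OrthonormalUpTo u n) (x : F) :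
    ∑ j ∈ Finset.range (n + 1), ⟪u j, x⟫_ℝ ^ 2 ≤ ‖x‖ ^ 2 := by
  have h := norm_sub_sq_real x (∑ j ∈ Finset.range (n + 1), ⟪u j, x⟫_ℝ • u j)
  rw [hu.norm_sum_smul_sq, inner_sum] at h
  have h2 : ∑ j ∈ Finset.range (n + 1), ⟪x, ⟪u j, x⟫_ℝ • u j⟫_ℝ
      = ∑ j ∈ Finset.range (n + 1), ⟪u j, x⟫_ℝ ^ 2 := by
    refine Finset.sum_congr rfl fun i _ => ?_
    rw [real_inner_smul_right, real_inner_comm, sq]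
  rw [h2] at h
  nlinarith [sq_nonneg ‖x - ∑ j ∈ Finset.range (n + 1), ⟪u j, x⟫_ℝ • u j‖]

theorem OrthonormalUpTo.inner_pathLaplacian_self_le {u : ℕ → F} {N : ℕ}
    (hu : OrthonormalUpTo u N) (x : F) : ⟪x, pathLaplacian u N x⟫_ℝ ≤ 4 * ‖x‖ ^ 2 := by
  rw [inner_pathLaplacian_self]
  have h1 : ∑ i ∈ Finset.range N, (⟪u i, x⟫_ℝ - ⟪u (i + 1), x⟫_ℝ) ^ 2 ≤
      2 * ∑ i ∈ Finset.range N, ⟪u i, x⟫_ℝ ^ 2 +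
        2 * ∑ i ∈ Finset.range N, ⟪u (i + 1), x⟫_ℝ ^ 2 := by
    rw [Finset.mul_sum, Finset.mul_sum, ← Finset.sum_add_distrib]
    refine Finset.sum_le_sum fun i _ => ?_
    nlinarith [sq_nonneg (⟪u i, x⟫_ℝ + ⟪u (i + 1), x⟫_ℝ)]
  have h2 := hu.sum_inner_sq_le x
  have h3 := h2
  rw [Finset.sum_range_succ] at h2
  rw [Finset.sum_range_succ'] at h3
  nlinarith [sq_nonneg ⟪u N, x⟫_ℝ, sq_nonneg ⟪u 0, x⟫_ℝ]

/-- All path Laplacians of the same length have the same non-zero eigenvalues: an eigenvector is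
transported by its coordinates along the orthonormal family. -/
theorem OrthonormalUpTo.hasEigenvalue_pathLaplacian {u v : ℕ → F} {N : ℕ}
    (hu : OrthonormalUpTo u N) (hv : OrthonormalUpTo v N) {l : ℝ} (hl : l ≠ 0)
    (h : Module.End.HasEigenvalue (pathLaplacian u N) l) :
    Module.End.HasEigenvalue (pathLaplacian v N) l := by
  obtain ⟨z, hz⟩ := h.exists_hasEigenvector
  have hz1 : pathLaplacian u N z = l • z := hz.apply_eq_smul
  set z' : F := ∑ j ∈ Finset.range (N + 1), ⟪u j, z⟫_ℝ • v j with hz'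
  have hd : ∀ i ∈ Finset.range N, ⟪v i - v (i + 1), z'⟫_ℝ = ⟪u i - u (i + 1), z⟫_ℝ := by
    intro i hi
    have hi' := Finset.mem_range.1 hi
    rw [inner_sub_left, inner_sub_left, hv.inner_sum_smul _ (by omega),
      hv.inner_sum_smul _ (by omega)]
  have hne : z' ≠ 0 := by
    intro h0
    have : pathLaplacian u N z = 0 := by
      rw [pathLaplacian_apply]
      refine Finset.sum_eq_zero fun i hi => ?_
      rw [← hd i hi, h0, inner_zero_right, zero_smul]
    rw [hz1] at this
    exact (smul_ne_zero hl hz.2) this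
  -- The coordinates of the two images agree.
  have hcoord : ∀ j ≤ N, ∀ i < N, ⟪v j, v i - v (i + 1)⟫_ℝ = ⟪u j, u i - u (i + 1)⟫_ℝ := by
    intro j hj i hi
    rw [inner_sub_right, inner_sub_right, hv j hj i (by omega), hv j hj (i + 1) (by omega),
      hu j hj i (by omega), hu j hj (i + 1) (by omega)]
  have hspan : ∀ i < N,
      v i - v (i + 1) = ∑ j ∈ Finset.range (N + 1), ⟪v j, v i - v (i + 1)⟫_ℝ • v j := by
    intro i hi
    simp_rw [inner_sub_right, sub_smul]
    rw [Finset.sum_sub_distrib, Finset.sum_eq_single i, Finset.sum_eq_single (i + 1)]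
    · rw [hv i (by omega) i (by omega), hv (i + 1) (by omega) (i + 1) (by omega)]; simp
    · intro j hj hne
      rw [hv j (by simpa [Nat.lt_succ_iff] using hj) (i + 1) (by omega)]; simp [hne]
    · intro h; exact absurd (Finset.mem_range.2 (by omega)) h
    · intro j hj hne
      rw [hv j (by simpa [Nat.lt_succ_iff] using hj) i (by omega)]; simp [hne]
    · intro h; exact absurd (Finset.mem_range.2 (by omega)) h
  refine Module.End.hasEigenvalue_of_hasEigenvector (x := z') ?_
  rw [Module.End.hasEigenvector_iff, Module.End.mem_eigenspace_iff]
  refine ⟨?_, hne⟩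
  calc pathLaplacian v N z'
      = ∑ i ∈ Finset.range N, ⟪u i - u (i + 1), z⟫_ℝ •
          ∑ j ∈ Finset.range (N + 1), ⟪u j, u i - u (i + 1)⟫_ℝ • v j := by
        rw [pathLaplacian_apply]
        refine Finset.sum_congr rfl fun i hi => ?_
        rw [hd i hi]
        congr 1
        rw [hspan i (Finset.mem_range.1 hi)]
        refine Finset.sum_congr rfl fun j hj => ?_
        rw [hcoord j (by simpa [Nat.lt_succ_iff] using hj) i (Finset.mem_range.1 hi)]
    _ = ∑ j ∈ Finset.range (N + 1), ⟪u j, pathLaplacian u N z⟫_ℝ • v j := by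
        simp_rw [Finset.smul_sum]
        rw [Finset.sum_comm]
        refine Finset.sum_congr rfl fun j _ => ?_
        rw [pathLaplacian_apply, inner_sum, Finset.sum_smul]
        refine Finset.sum_congr rfl fun i _ => ?_
        rw [real_inner_smul_right, smul_smul]
    _ = l • z' := by
        rw [hz1, hz', Finset.smul_sum]
        refine Finset.sum_congr rfl fun j _ => ?_
        rw [real_inner_smul_right, smul_smul]

/-- The largest eigenvalue of a path Laplacian is positive and at most `4`. -/
theorem OrthonormalUpTo.exists_max_eigenvalue [FiniteDimensional ℝ F] {u : ℕ → F} {N : ℕ}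
    (hu : OrthonormalUpTo u N) (hN : 1 ≤ N) :
    ∃ l : ℝ, 0 < l ∧ l ≤ 4 ∧
      IsGreatest {l | Module.End.HasEigenvalue (pathLaplacian u N) l} l := by
  have hu0 : ⟪u 0, u 0⟫_ℝ = 1 := by simpa using hu 0 (by omega) 0 (by omega)
  have hu0ne : u 0 ≠ 0 := by intro h; simp [h] at hu0
  have : Nontrivial F := ⟨u 0, 0, hu0ne⟩
  have hmax := (isSymmetric_pathLaplacian u N).hasEigenvalue_iSup_of_finiteDimensional
  set R : {x : F // x ≠ 0} → ℝ :=
    fun x => RCLike.re ⟪pathLaplacian u N x, (x : F)⟫_ℝ / ‖(x : F)‖ ^ 2 with hR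
  have hle : ∀ x, R x ≤ 4 := by
    intro x
    have hx : 0 < ‖(x : F)‖ ^ 2 := by have := norm_pos_iff.2 x.2; positivity
    rw [hR]
    simp only [RCLike.re_to_real]
    rw [div_le_iff₀ hx, real_inner_comm]
    exact hu.inner_pathLaplacian_self_le x
  have hbdd : BddAbove (Set.range R) := ⟨4, by rintro _ ⟨x, rfl⟩; exact hle x⟩
  have hne : Nonempty {x : F // x ≠ 0} := ⟨⟨u 0, hu0ne⟩⟩
  refine ⟨⨆ x, R x, ?_, ciSup_le hle, ?_, ?_⟩
  · refine lt_of_lt_of_le ?_ (le_ciSup hbdd ⟨u 0, hu0ne⟩)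
    rw [hR]
    simp only [RCLike.re_to_real]
    have hn : ‖u 0‖ ^ 2 = 1 := by rw [← real_inner_self_eq_norm_sq, hu0]
    rw [real_inner_comm, hn, div_one, inner_pathLaplacian_self]
    refine Finset.sum_pos' (fun i _ => sq_nonneg _) ⟨0, Finset.mem_range.2 (by omega), ?_⟩
    rw [hu0, hu 1 hN 0 (by omega)]
    norm_num
  · simpa using hmax
  · intro l hl
    obtain ⟨z, hz⟩ := Module.End.HasEigenvalue.exists_hasEigenvector hl
    refine le_trans (le_of_eq ?_) (le_ciSup hbdd ⟨z, hz.2⟩)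
    have hpos : 0 < ‖z‖ := norm_pos_iff.2 hz.2
    rw [hR]
    simp only [RCLike.re_to_real]
    rw [hz.apply_eq_smul, real_inner_smul_left, real_inner_self_eq_norm_sq]
    field_simp

/-- The discrete Sobolev inequality on a path of `N + 1` vertices. -/
theorem sq_last_le_sum_sq (N : ℕ) (z : ℕ → ℝ) :
    ((N : ℝ) + 1) * z N ^ 2 ≤ 2 * ∑ i ∈ Finset.range (N + 1), z i ^ 2 +
      2 * N * (N + 1) * ∑ i ∈ Finset.range N, (z i - z (i + 1)) ^ 2 := by
  have hstep : ∀ i ∈ Finset.range (N + 1),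
      z N ^ 2 ≤ 2 * z i ^ 2 + 2 * (N * ∑ i ∈ Finset.range N, (z i - z (i + 1)) ^ 2) := by
    intro i hi
    have hi' : i ≤ N := by simpa [Nat.lt_succ_iff] using hi
    have htel : z N - z i = ∑ j ∈ Finset.Ico i N, (z (j + 1) - z j) :=
      (Finset.sum_Ico_sub z hi').symm
    have hcs : (z N - z i) ^ 2 ≤ N * ∑ j ∈ Finset.range N, (z j - z (j + 1)) ^ 2 := by
      rw [htel]
      refine (sq_sum_le_card_mul_sum_sq).trans ?_
      rw [Nat.card_Ico]
      have hsub : ∑ j ∈ Finset.Ico i N, (z (j + 1) - z j) ^ 2 ≤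
          ∑ j ∈ Finset.range N, (z j - z (j + 1)) ^ 2 := by
        have : ∀ j ∈ Finset.Ico i N, (z (j + 1) - z j) ^ 2 = (z j - z (j + 1)) ^ 2 :=
          fun j _ => by ring
        rw [Finset.sum_congr rfl this]
        refine Finset.sum_le_sum_of_subset_of_nonneg ?_ fun j _ _ => sq_nonneg _
        intro j hj
        exact Finset.mem_range.2 (Finset.mem_Ico.1 hj).2
      have hcast : ((N - i : ℕ) : ℝ) ≤ N := by exact_mod_cast Nat.sub_le N i
      exact mul_le_mul hcast hsub (Finset.sum_nonneg fun j _ => sq_nonneg _) (by positivity)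
    nlinarith [sq_nonneg (2 * z i - z N)]
  have := Finset.sum_le_sum hstep
  rw [Finset.sum_const, Finset.card_range, Finset.sum_add_distrib, ← Finset.mul_sum,
    Finset.sum_const, Finset.card_range, nsmul_eq_mul, nsmul_eq_mul] at this
  push_cast at this
  linarith

end PathLaplacian

/-! ### First-order properties of the regularized quadratic -/

section Objective

variable {d : ℕ} {p s : ℝ}

/-- The gradient `A x - b + s ‖x‖ ^ (p - 2) x` of the regularized quadratic. -/
noncomputable def objectiveGrad (p s : ℝ) (A : Matrix (Fin d) (Fin d) ℝ) (b x : E d) : E d :=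
  Matrix.toEuclideanLin A x - b + (s * ‖x‖ ^ (p - 2)) • x

theorem hasGradientAt_objective (hp : 2 < p) {A : Matrix (Fin d) (Fin d) ℝ}
    (hA : A.PosSemidef) (b x : E d) :
    HasGradientAt (objective p s A b) (objectiveGrad p s A b x) x := by
  have hsym : (Matrix.toEuclideanLin A).IsSymmetric :=
    (Matrix.isPositive_toEuclideanLin_iff.2 hA).isSymmetric
  have hlin := (LinearMap.toContinuousLinearMap (Matrix.toEuclideanLin A)).hasFDerivAt (x := x)
  have h1 := ((hasFDerivAt_id (𝕜 := ℝ) x).inner ℝ hlin).const_mul (1 / 2 : ℝ)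
  have h2 := (innerSL ℝ b).hasFDerivAt (x := x)
  have h3 := (hasFDerivAt_norm_rpow x (p := p) (by linarith)).const_mul (s / p)
  rw [hasGradientAt_iff_hasFDerivAt]
  refine HasFDerivAt.congr_fderiv ((h1.sub h2).add h3) ?_
  ext v
  have hs : ⟪x, Matrix.toEuclideanLin A v⟫_ℝ = ⟪Matrix.toEuclideanLin A x, v⟫_ℝ := (hsym x v).symm
  have hc : ⟪v, Matrix.toEuclideanLin A x⟫_ℝ = ⟪Matrix.toEuclideanLin A x, v⟫_ℝ :=
    real_inner_comm _ _
  have hp0 : p ≠ 0 := by linarith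
  simp only [objectiveGrad, InnerProductSpace.toDual_apply_apply, inner_add_left, inner_sub_left,
    real_inner_smul_left]
  simp [fderivInnerCLM_apply, hs, hc]
  field_simp
  ring

theorem gradient_objective (hp : 2 < p) {A : Matrix (Fin d) (Fin d) ℝ}
    (hA : A.PosSemidef) (b x : E d) :
    gradient (objective p s A b) x = objectiveGrad p s A b x :=
  (hasGradientAt_objective hp hA b x).gradient

/-- At a point where two matrices act in the same way, the first-order oracles of the two
regularized quadratics give the same answer. -/
theorem oracle_objective_congr (hp : 2 < p) {A A' : Matrix (Fin d) (Fin d) ℝ}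
    (hA : A.PosSemidef) (hA' : A'.PosSemidef) {b x : E d}
    (h : Matrix.toEuclideanLin A x = Matrix.toEuclideanLin A' x) :
    oracle (objective p s A b) x = oracle (objective p s A' b) x := by
  simp only [oracle, gradient_objective hp hA, gradient_objective hp hA', objectiveGrad, objective,
    h]

/-- The tangent line inequality for the convex function `t ↦ t ^ (p / 2)`, at `t = x ^ 2`. -/
theorem half_rpow_mul_sub_sq_le (hp : 2 < p) {x y : ℝ} (hx : 0 ≤ x) (hy : 0 ≤ y) :
    1 / 2 * x ^ (p - 2) * (y ^ 2 - x ^ 2) ≤ y ^ p / p - x ^ p / p := by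
  have hp0 : 0 < p := by linarith
  have h := Real.geom_mean_le_arith_mean2_weighted (w₁ := (p - 2) / p) (w₂ := 2 / p)
    (p₁ := x ^ p) (p₂ := y ^ p) (div_nonneg (by linarith) hp0.le) (by positivity)
    (by positivity) (by positivity) (by field_simp; ring)
  rw [← Real.rpow_mul hx, ← Real.rpow_mul hy, mul_div_cancel₀ _ hp0.ne',
    mul_div_cancel₀ _ hp0.ne', Real.rpow_two] at h
  have hxx : x ^ (p - 2) * x ^ 2 = x ^ p := by
    rw [← Real.rpow_two, ← Real.rpow_add_of_nonneg hx (by linarith) (by norm_num)]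
    congr 1; ring
  have h2 : 1 / 2 * x ^ (p - 2) * (y ^ 2 - x ^ 2) =
      1 / 2 * (x ^ (p - 2) * y ^ 2) - 1 / 2 * x ^ p := by rw [← hxx]; ring
  have h3 : 1 / 2 * ((p - 2) / p * x ^ p + 2 / p * y ^ p) =
      y ^ p / p - x ^ p / p + 1 / 2 * x ^ p := by field_simp; ring
  linarith

/-- The regularized quadratic lies above its tangent plane at `x` by at least half the quadratic
form of `A + s ‖x‖ ^ (p - 2)`. -/
theorem objective_sub_ge (hp : 2 < p) (hs : 0 < s) {A : Matrix (Fin d) (Fin d) ℝ}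
    (hA : A.PosSemidef) (b x y : E d) :
    1 / 2 * (⟪y - x, Matrix.toEuclideanLin A (y - x)⟫_ℝ + s * ‖x‖ ^ (p - 2) * ‖y - x‖ ^ 2) ≤
      objective p s A b y - objective p s A b x - ⟪objectiveGrad p s A b x, y - x⟫_ℝ := by
  have hsym : (Matrix.toEuclideanLin A).IsSymmetric :=
    (Matrix.isPositive_toEuclideanLin_iff.2 hA).isSymmetric
  obtain ⟨z, rfl⟩ : ∃ z, y = x + z := ⟨y - x, by abel⟩
  have h1 := mul_le_mul_of_nonneg_left
    (half_rpow_mul_sub_sq_le hp (norm_nonneg x) (norm_nonneg (x + z))) hs.le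
  rw [norm_add_sq_real] at h1
  have hxz : ⟪x, Matrix.toEuclideanLin A z⟫_ℝ = ⟪Matrix.toEuclideanLin A x, z⟫_ℝ := (hsym x z).symm
  have hzx : ⟪z, Matrix.toEuclideanLin A x⟫_ℝ = ⟪Matrix.toEuclideanLin A x, z⟫_ℝ :=
    real_inner_comm _ _
  simp only [objective, objectiveGrad, add_sub_cancel_left, map_add, inner_add_left,
    inner_add_right, inner_sub_left, real_inner_smul_left, hxz, hzx]
  have h2 : s / p * ‖x + z‖ ^ p - s / p * ‖x‖ ^ p = s * (‖x + z‖ ^ p / p - ‖x‖ ^ p / p) := by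
    ring
  linarith

end Objective

/-! ### The resisting oracle -/

section Resisting

variable {d : ℕ}

/-- The matrix of `a` times the path Laplacian on `u 0, …, u N`. -/
noncomputable def pathMatrix (a : ℝ) (u : ℕ → E d) (N : ℕ) : Matrix (Fin d) (Fin d) ℝ :=
  Matrix.toEuclideanLin.symm (a • pathLaplacian u N)

theorem toEuclideanLin_pathMatrix (a : ℝ) (u : ℕ → E d) (N : ℕ) :
    Matrix.toEuclideanLin (pathMatrix a u N) = a • pathLaplacian u N := by
  simp [pathMatrix]

theorem posSemidef_pathMatrix {a : ℝ} (ha : 0 ≤ a) (u : ℕ → E d) (N : ℕ) :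
    (pathMatrix a u N).PosSemidef := by
  rw [← Matrix.isPositive_toEuclideanLin_iff, toEuclideanLin_pathMatrix]
  refine ⟨fun x y => ?_, fun x => ?_⟩
  · rw [LinearMap.smul_apply, LinearMap.smul_apply, real_inner_smul_left, real_inner_smul_right,
      isSymmetric_pathLaplacian u N x y]
  · rw [LinearMap.smul_apply, real_inner_smul_left, real_inner_comm]
    exact mul_nonneg ha (inner_pathLaplacian_self_nonneg u N x)

theorem exists_unit_orthogonal (t : Finset (E d)) (ht : t.card < d) :
    ∃ v : E d, ⟪v, v⟫_ℝ = 1 ∧ ∀ x ∈ t, ⟪x, v⟫_ℝ = 0 := by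
  set K := Submodule.span ℝ (t : Set (E d))
  have hK : Module.finrank ℝ K ≤ t.card := finrank_span_finset_le_card t
  have hne : Kᗮ ≠ ⊥ := by
    intro h
    rw [Submodule.orthogonal_eq_bot_iff] at h
    rw [h, finrank_top, finrank_euclideanSpace_fin] at hK
    omega
  obtain ⟨y, hy, hy0⟩ := Submodule.exists_mem_ne_zero_of_ne_bot hne
  refine ⟨‖y‖⁻¹ • y, ?_, fun x hx => ?_⟩
  · rw [real_inner_self_eq_norm_sq, norm_smul, norm_inv, norm_norm,
      inv_mul_cancel₀ (norm_ne_zero_iff.2 hy0), one_pow]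
  · rw [real_inner_smul_right, hy x (Submodule.subset_span hx), mul_zero]

/-- For any method and any `k` with `2 * k + 1 ≤ d` there is an orthonormal family `u 0, …, u k`
such that each iterate `x j` with `j ≤ k` of the method on the path instance is orthogonal to
`u j, …, u k`. The vector `u (k + 1)` is chosen after `x (k + 1)` is known: since the answers of the
oracle at `x 0, …, x k` involve only `u 0, …, u k`, adding it to the instance does not change them.
The family is extended by zero beyond `k`. -/
theorem exists_resisting_family {p s a : ℝ} (hp : 2 < p) (ha : 0 ≤ a) (γ : ℝ) (N : ℕ)
    (M : FirstOrderMethod d) (k : ℕ) (hk : 2 * k + 1 ≤ d) :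
    ∃ u : ℕ → E d, OrthonormalUpTo u k ∧ (∀ i, k < i → u i = 0) ∧
      ∀ j ≤ k, ∀ i, j ≤ i →
        ⟪u i, iterate M (objective p s (pathMatrix a u N) (γ • u 0)) j⟫_ℝ = 0 := by
  classical
  induction k with
  | zero =>
    obtain ⟨v, hv, -⟩ := exists_unit_orthogonal (∅ : Finset (E d)) (by rw [Finset.card_empty]; omega)
    refine ⟨fun i => if i = 0 then v else 0, ?_, ?_, ?_⟩
    · intro i hi j hj
      obtain rfl : i = 0 := by omega
      obtain rfl : j = 0 := by omega
      simpa using hv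
    · intro i hi
      simp [show i ≠ 0 by omega]
    · intro j hj i _
      obtain rfl : j = 0 := by omega
      rw [iterate_zero, inner_zero_right]
  | succ k ih =>
    obtain ⟨u, hu, hu0, hux⟩ := ih (by omega)
    set x : ℕ → E d := iterate M (objective p s (pathMatrix a u N) (γ • u 0)) with hx
    obtain ⟨v, hv, hvt⟩ := exists_unit_orthogonal
      ((Finset.range (k + 1)).image u ∪ (Finset.range (k + 1)).image fun j => x (j + 1)) (by
        refine lt_of_le_of_lt (Finset.card_union_le _ _) ?_
        have h1 := Finset.card_image_le (s := Finset.range (k + 1)) (f := u)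
        have h2 := Finset.card_image_le (s := Finset.range (k + 1)) (f := fun j => x (j + 1))
        rw [Finset.card_range] at h1 h2
        omega)
    have hvu : ∀ i ≤ k, ⟪u i, v⟫_ℝ = 0 := fun i hi =>
      hvt _ (Finset.mem_union_left _ (Finset.mem_image_of_mem _ (Finset.mem_range.2 (by omega))))
    have hvx : ∀ j ≤ k + 1, ⟪x j, v⟫_ℝ = 0 := by
      intro j hj
      rcases j with _ | j
      · rw [hx, iterate_zero, inner_zero_left]
      · exact hvt _ (Finset.mem_union_right _
          (Finset.mem_image_of_mem (fun j => x (j + 1)) (Finset.mem_range.2 (by omega))))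
    set u' : ℕ → E d := Function.update u (k + 1) v with hu'
    have hlow : ∀ i, i ≠ k + 1 → u' i = u i := fun i hi => Function.update_of_ne hi _ _
    have htop : u' (k + 1) = v := Function.update_self _ _ _
    have hux' : ∀ j ≤ k + 1, ∀ i, j ≤ i → ⟪u' i, x j⟫_ℝ = 0 := by
      intro j hj i hi
      rcases eq_or_ne i (k + 1) with rfl | hne
      · rw [htop, real_inner_comm]; exact hvx j hj
      · rw [hlow i hne]
        rcases Nat.lt_or_ge k i with hki | hki
        · rw [hu0 i hki, inner_zero_left]
        · exact hux j (by omega) i hi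
    have hop : ∀ j ≤ k, Matrix.toEuclideanLin (pathMatrix a u' N) (x j) =
        Matrix.toEuclideanLin (pathMatrix a u N) (x j) := by
      intro j hj
      rw [toEuclideanLin_pathMatrix, toEuclideanLin_pathMatrix, LinearMap.smul_apply,
        LinearMap.smul_apply, pathLaplacian_apply, pathLaplacian_apply]
      congr 1
      refine Finset.sum_congr rfl fun i _ => ?_
      rcases Nat.lt_or_ge i k with hik | hik
      · rw [hlow i (by omega), hlow (i + 1) (by omega)]
      · rw [inner_sub_left, inner_sub_left, hux' j (by omega) i (by omega),
          hux' j (by omega) (i + 1) (by omega), hux j hj i (by omega),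
          hux j hj (i + 1) (by omega)]
        simp
    have hiter : ∀ j ≤ k + 1,
        iterate M (objective p s (pathMatrix a u' N) (γ • u' 0)) j = x j := by
      intro j
      induction j using Nat.strong_induction_on with
      | _ j ihj =>
        intro hj
        rcases j with _ | j
        · rw [hx, iterate_zero, iterate_zero]
        · rw [hx, iterate_succ, iterate_succ]
          congr 1
          funext i
          have hi := i.isLt
          rw [ihj i (by omega) (by omega), hlow 0 (by omega)]
          exact oracle_objective_congr hp (posSemidef_pathMatrix ha u' N)
            (posSemidef_pathMatrix ha u N) (hop i (by omega))
    refine ⟨u', ?_, ?_, ?_⟩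
    · intro i hi j hj
      rcases eq_or_ne i (k + 1) with rfl | hi1 <;> rcases eq_or_ne j (k + 1) with rfl | hj1
      · rw [htop, hv, if_pos rfl]
      · rw [htop, hlow j hj1, real_inner_comm, hvu j (by omega), if_neg (Ne.symm hj1)]
      · rw [htop, hlow i hi1, hvu i (by omega), if_neg hi1]
      · rw [hlow i hi1, hlow j hj1]; exact hu i (by omega) j (by omega)
    · intro i hi
      rw [hlow i (by omega), hu0 i (by omega)]
    · intro j hj i hi
      rw [hiter j hj]
      exact hux' j hj i hi

/-- The factor `L / l`, with `l` the largest eigenvalue of the path Laplacian, normalizes the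
largest eigenvalue to `L`; it does not depend on the orthonormal family. -/
theorem exists_scale_isMaxEigenvalue {L : ℝ} (hL : 0 < L) {N : ℕ} (hN : 1 ≤ N) (hd : N + 1 ≤ d) :
    ∃ a : ℝ, L / 4 ≤ a ∧
      ∀ u : ℕ → E d, OrthonormalUpTo u N → IsMaxEigenvalue (pathMatrix a u N) L := by
  set e : ℕ → E d :=
    fun i => if h : i < d then EuclideanSpace.basisFun (Fin d) ℝ ⟨i, h⟩ else 0 with he
  have heo : OrthonormalUpTo e N := by
    intro i hi j hj
    simp only [he, dif_pos (show i < d by omega), dif_pos (show j < d by omega)]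
    rw [orthonormal_iff_ite.1 (EuclideanSpace.basisFun (Fin d) ℝ).orthonormal]
    simp
  obtain ⟨l, hl0, hl4, hl, hlmax⟩ := heo.exists_max_eigenvalue hN
  refine ⟨L / l, div_le_div_of_nonneg_left hL.le hl0 hl4, fun u hu => ⟨?_, ?_⟩⟩
  · obtain ⟨z, hz⟩ := (heo.hasEigenvalue_pathLaplacian hu hl0.ne' hl).exists_hasEigenvector
    refine Module.End.hasEigenvalue_of_hasEigenvector (x := z) ?_
    rw [Module.End.hasEigenvector_iff, Module.End.mem_eigenspace_iff, toEuclideanLin_pathMatrix,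
      LinearMap.smul_apply, hz.apply_eq_smul, smul_smul, div_mul_cancel₀ _ hl0.ne']
    exact ⟨rfl, hz.2⟩
  · intro m hm
    rcases le_or_gt m 0 with hm0 | hm0
    · exact hm0.trans hL.le
    obtain ⟨z, hz⟩ := Module.End.HasEigenvalue.exists_hasEigenvector hm
    have hz1 := hz.apply_eq_smul
    rw [toEuclideanLin_pathMatrix, LinearMap.smul_apply] at hz1
    have hz2 : pathLaplacian u N z = (m * l / L) • z := by
      have : pathLaplacian u N z = (l / L) • ((L / l) • pathLaplacian u N z) := by
        rw [smul_smul, show l / L * (L / l) = 1 by field_simp, one_smul]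
      rw [this, hz1, smul_smul]
      congr 1; ring
    have hev : Module.End.HasEigenvalue (pathLaplacian u N) (m * l / L) := by
      refine Module.End.hasEigenvalue_of_hasEigenvector (x := z) ?_
      rw [Module.End.hasEigenvector_iff, Module.End.mem_eigenspace_iff]
      exact ⟨hz2, hz.2⟩
    have := hlmax (hu.hasEigenvalue_pathLaplacian heo (by positivity) hev)
    rw [div_le_iff₀ hL, mul_comm l L] at this
    exact le_of_mul_le_mul_right this hl0

end Resisting

/-! ### The minimizer of the path instance -/

section Profile

/-- The pair `(w j, S j)` with `w 0 = 1`, `w (j + 1) = w j + ε S j` and `S j = w 0 + ⋯ + w j`. -/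
noncomputable def profilePair (ε : ℝ) : ℕ → ℝ × ℝ
  | 0 => (1, 1)
  | j + 1 => ((profilePair ε j).1 + ε * (profilePair ε j).2,
      (profilePair ε j).2 + ((profilePair ε j).1 + ε * (profilePair ε j).2))

/-- The coordinates, counted from the far end of the path, of the solution of
`(Laplacian + ε) w = const • u 0`, normalized by `w 0 = 1`. -/
noncomputable def profile (ε : ℝ) (j : ℕ) : ℝ := (profilePair ε j).1

/-- The partial sums `S j = w 0 + ⋯ + w j` of the profile. -/
noncomputable def profileSum (ε : ℝ) (j : ℕ) : ℝ := (profilePair ε j).2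

theorem profile_succ (ε : ℝ) (j : ℕ) :
    profile ε (j + 1) = profile ε j + ε * profileSum ε j := rfl

theorem profileSum_succ (ε : ℝ) (j : ℕ) :
    profileSum ε (j + 1) = profileSum ε j + profile ε (j + 1) := rfl

theorem profile_bounds {ε : ℝ} (hε : 0 ≤ ε) (j : ℕ) :
    1 ≤ profile ε j ∧ 0 ≤ profileSum ε j ∧ profileSum ε j ≤ (j + 1) * profile ε j := by
  induction j with
  | zero => simp [profile, profileSum, profilePair]
  | succ j ih =>
    obtain ⟨h1, h2, h3⟩ := ih
    have h4 := mul_nonneg hε h2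
    rw [profileSum_succ, profile_succ]
    push_cast
    refine ⟨by linarith, by linarith, ?_⟩
    nlinarith [mul_nonneg (Nat.cast_nonneg (α := ℝ) j) h4]

theorem profile_le_pow {ε : ℝ} (hε : 0 ≤ ε) (n j : ℕ) (hj : j ≤ n) :
    profile ε j ≤ (1 + ε * n) ^ j := by
  induction j with
  | zero => simp [profile, profilePair]
  | succ j ih =>
    obtain ⟨h1, -, h3⟩ := profile_bounds hε j
    have hjn : ((j : ℝ) + 1) ≤ n := by exact_mod_cast hj
    rw [profile_succ, pow_succ]
    calc profile ε j + ε * profileSum ε j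
        ≤ profile ε j + ε * (n * profile ε j) := by
          have := mul_le_mul_of_nonneg_right hjn (by linarith : 0 ≤ profile ε j)
          gcongr
          linarith
      _ = profile ε j * (1 + ε * n) := by ring
      _ ≤ (1 + ε * n) ^ j * (1 + ε * n) := by gcongr; exact ih (by omega)

/-- For `ε` of order `1 / N ^ 2` the profile is bounded by an absolute constant on the whole
path. -/
theorem profile_le_exp {ε : ℝ} (hε : 0 ≤ ε) {N : ℕ} (hN : 1 ≤ N) (hεN : ε ≤ 4 / (N : ℝ) ^ 2)
    {j : ℕ} (hj : j ≤ N) : profile ε j ≤ Real.exp 4 := by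
  have hN0 : (0 : ℝ) < N := by exact_mod_cast hN
  have h1 : ε * N ≤ 4 / N := by
    calc ε * N ≤ 4 / (N : ℝ) ^ 2 * N := by gcongr
      _ = 4 / N := by field_simp
  calc profile ε j ≤ (1 + ε * N) ^ j := profile_le_pow hε N j hj
    _ ≤ (1 + ε * N) ^ N := pow_le_pow_right₀ (by nlinarith) hj
    _ ≤ Real.exp (4 / N) ^ N := by
        gcongr
        linarith [Real.add_one_le_exp (4 / (N : ℝ))]
    _ = Real.exp 4 := by rw [← Real.exp_nat_mul]; congr 1; field_simp

variable {F : Type*} [NormedAddCommGroup F] [InnerProductSpace ℝ F]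

/-- The profile, read from the far end of the path, solves `(Laplacian + ε) x = ε S N • u 0`. -/
theorem OrthonormalUpTo.pathLaplacian_profile {u : ℕ → F} {N : ℕ} (hu : OrthonormalUpTo u N)
    (ε : ℝ) :
    pathLaplacian u N (∑ j ∈ Finset.range (N + 1), profile ε (N - j) • u j) +
      ε • ∑ j ∈ Finset.range (N + 1), profile ε (N - j) • u j = (ε * profileSum ε N) • u 0 := by
  have hstep : ∀ i < N, ∃ m, N - i = m + 1 ∧ N - (i + 1) = m := fun i hi => ⟨N - (i + 1), by omega⟩
  have hcoef : ∀ i ∈ Finset.range N,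
      ⟪u i - u (i + 1), ∑ j ∈ Finset.range (N + 1), profile ε (N - j) • u j⟫_ℝ •
        (u i - u (i + 1)) = ε • profileSum ε (N - (i + 1)) • (u i - u (i + 1)) := by
    intro i hi
    have hi' := Finset.mem_range.1 hi
    obtain ⟨m, hm, hm'⟩ := hstep i hi'
    rw [inner_sub_left, hu.inner_sum_smul (fun j => profile ε (N - j)) (by omega),
      hu.inner_sum_smul (fun j => profile ε (N - j)) (by omega), smul_smul]
    congr 1
    rw [hm, hm', profile_succ]; ring
  -- The sum telescopes, because `S (m + 1) = S m + w (m + 1)`.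
  have htel : ∀ n ≤ N, ∑ i ∈ Finset.range n, (profileSum ε (N - (i + 1)) • (u i - u (i + 1)) +
      profile ε (N - i) • u i) = profileSum ε N • u 0 - profileSum ε (N - n) • u n := by
    intro n
    induction n with
    | zero => intro _; simp
    | succ n ih =>
      intro hn
      obtain ⟨m, hm, hm'⟩ := hstep n (by omega)
      rw [Finset.sum_range_succ, ih (by omega), hm, hm', profileSum_succ]
      module
  have h := htel N le_rfl
  rw [Finset.sum_add_distrib, Nat.sub_self] at h
  rw [pathLaplacian_apply, Finset.sum_congr rfl hcoef, ← Finset.smul_sum, ← smul_add,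
    Finset.sum_range_succ (fun j => profile ε (N - j) • u j), ← add_assoc, h, Nat.sub_self,
    mul_smul]
  have h0 : profileSum ε 0 = profile ε 0 := rfl
  rw [h0, sub_add_cancel]

end Profile

/-- The last coordinate controls the energy: if it is `ρ`, the quadratic form of
`a * Laplacian + μ` with `μ = L / N ^ 2` is at least `μ (N + 1) ρ ^ 2 / 16`. -/
theorem OrthonormalUpTo.energy_ge {F : Type*} [NormedAddCommGroup F] [InnerProductSpace ℝ F]
    {u : ℕ → F} {N : ℕ} (hu : OrthonormalUpTo u N) (hN : 1 ≤ N) {a L : ℝ} (hL : 0 < L)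
    (ha : L / 4 ≤ a) (z : F) :
    L / (N : ℝ) ^ 2 * ((N + 1) * ⟪u N, z⟫_ℝ ^ 2) / 16 ≤
      a * ⟪z, pathLaplacian u N z⟫_ℝ + L / (N : ℝ) ^ 2 * ‖z‖ ^ 2 := by
  have hN1 : (1 : ℝ) ≤ N := by exact_mod_cast hN
  have hN0 : (0 : ℝ) < N := by linarith
  set μ := L / (N : ℝ) ^ 2 with hμ
  have hμ0 : 0 < μ := by positivity
  have hG := inner_pathLaplacian_self_nonneg u N z
  have hsob := sq_last_le_sum_sq N fun i => ⟪u i, z⟫_ℝ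
  rw [← inner_pathLaplacian_self] at hsob
  have hb := hu.sum_inner_sq_le z
  have haG := mul_le_mul_of_nonneg_right ha hG
  have h1 : μ * ((N + 1) * ⟪u N, z⟫_ℝ ^ 2) ≤
      μ * (2 * ‖z‖ ^ 2 + 2 * N * (N + 1) * ⟪z, pathLaplacian u N z⟫_ℝ) := by
    gcongr
    linarith
  have h2 : μ * (2 * N * (N + 1)) ≤ 4 * L := by
    rw [hμ, div_mul_eq_mul_div, div_le_iff₀ (by positivity)]
    have h : 2 * (N : ℝ) * (N + 1) ≤ 4 * (N : ℝ) ^ 2 := by nlinarith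
    nlinarith [mul_le_mul_of_nonneg_left h hL.le]
  have h3 := mul_le_mul_of_nonneg_right h2 hG
  nlinarith [mul_nonneg hμ0.le (sq_nonneg ‖z‖)]

/-! ### The lower bound -/

theorem div_rpow_rpow_eq {μ s α β δ : ℝ} (hμ : 0 < μ) (hs : 0 < s) (hαβ : α * β = δ)
    (hβ : β = 1 + δ) : (μ / s ^ α) ^ β = μ * (μ / s) ^ δ := by
  rw [Real.div_rpow hμ.le (by positivity), ← Real.rpow_mul hs.le, hαβ, hβ, Real.rpow_add hμ,
    Real.rpow_one, Real.div_rpow hμ.le hs.le, mul_div_assoc]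

/-- If `y` is a critical point and the quadratic form of `A + s ‖y‖ ^ (p - 2)` at `x - y` is at
least `e`, then at `x` the objective gap is at least `e / 2` and the squared norm of the
gradient is at least `μ e / 4`. -/
theorem gap_and_gradient_ge {d : ℕ} {p s μ e : ℝ} (hp : 2 < p) (hs : 0 < s) (he : 0 < e)
    {A : Matrix (Fin d) (Fin d) ℝ} (hA : A.PosSemidef) {b x y : E d}
    (hμ : s * ‖y‖ ^ (p - 2) = μ) (hμ0 : 0 < μ) (hy : objectiveGrad p s A b y = 0)
    (hE : e ≤ ⟪x - y, Matrix.toEuclideanLin A (x - y)⟫_ℝ + μ * ‖x - y‖ ^ 2) :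
    e / 2 ≤ objective p s A b x - objective p s A b y ∧
      μ * e / 4 ≤ ‖objectiveGrad p s A b x‖ ^ 2 := by
  have hpos : ∀ v : E d, 0 ≤ ⟪v, Matrix.toEuclideanLin A v⟫_ℝ := fun v => by
    have := (Matrix.isPositive_toEuclideanLin_iff.2 hA).2 v
    rw [real_inner_comm]
    exact this
  have hgap := objective_sub_ge hp hs hA b y x
  rw [hy, inner_zero_left, sub_zero, hμ] at hgap
  have hconv := objective_sub_ge hp hs hA b x y
  set g := objectiveGrad p s A b x
  have hconv0 : 0 ≤ ⟪y - x, Matrix.toEuclideanLin A (y - x)⟫_ℝ +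
      s * ‖x‖ ^ (p - 2) * ‖y - x‖ ^ 2 := add_nonneg (hpos _) (by positivity)
  have hflip : ⟪g, y - x⟫_ℝ = -⟪g, x - y⟫_ℝ := by rw [← inner_neg_right, neg_sub]
  have hcs := real_inner_le_norm g (x - y)
  have hEz : μ * ‖x - y‖ ^ 2 ≤
      ⟪x - y, Matrix.toEuclideanLin A (x - y)⟫_ℝ + μ * ‖x - y‖ ^ 2 := by linarith [hpos (x - y)]
  set Q := ⟪x - y, Matrix.toEuclideanLin A (x - y)⟫_ℝ + μ * ‖x - y‖ ^ 2
  have hQ : Q / 2 ≤ ‖g‖ * ‖x - y‖ := by linarith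
  refine ⟨by linarith, ?_⟩
  have hz : 0 < ‖x - y‖ := by
    rcases (norm_nonneg (x - y)).lt_or_eq with h | h
    · exact h
    · rw [← h, mul_zero] at hQ; linarith
  have h1 : (Q / 2) ^ 2 ≤ (‖g‖ * ‖x - y‖) ^ 2 := pow_le_pow_left₀ (by linarith) hQ 2
  have h2 : e * (μ * ‖x - y‖ ^ 2) ≤ Q * Q :=
    mul_le_mul hE hEz (by positivity) (by linarith)
  refine le_of_mul_le_mul_right ?_ (pow_pos hz 2)
  nlinarith

end RegQuad

open RegQuad

theorem theorem5 :
    ∃ c : ℝ, 0 < c ∧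
      ∀ (p s L : ℝ), 2 < p → 0 < s → 0 < L →
      ∀ (d N : ℕ), 1 ≤ N → (N : ℝ) ≤ ((d : ℝ) - 1) / 2 →
      ∀ M : RegQuad.FirstOrderMethod d,
      ∃ (A : Matrix (Fin d) (Fin d) ℝ) (b xstar : RegQuad.E d),
        A.PosSemidef ∧ RegQuad.IsMaxEigenvalue A L ∧
        (∀ x, RegQuad.objective p s A b xstar ≤ RegQuad.objective p s A b x) ∧
        c * (L / (s ^ (2 / p) * (N : ℝ) ^ 2)) ^ (p / (p - 2)) ≤
          RegQuad.objective p s A b (RegQuad.iterate M (RegQuad.objective p s A b) N)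
            - RegQuad.objective p s A b xstar ∧
        c * (L / (s ^ (1 / (p - 1)) * (N : ℝ) ^ 2)) ^ ((p - 1) / (p - 2)) ≤
          ‖gradient (RegQuad.objective p s A b)
            (RegQuad.iterate M (RegQuad.objective p s A b) N)‖ := by
  have hW1 : 1 ≤ Real.exp 4 := Real.one_le_exp (by norm_num)
  set W := Real.exp 4 with hW
  refine ⟨1 / (32 * W ^ 2), by positivity, ?_⟩
  intro p s L hp hs hL d N hN hdN M
  have hp2 : p - 2 ≠ 0 := by linarith
  have hp0 : p ≠ 0 := by linarith
  have hp1 : p - 1 ≠ 0 := by linarith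
  have hd : 2 * N + 1 ≤ d := by
    have : 2 * (N : ℝ) + 1 ≤ d := by linarith
    exact_mod_cast this
  have hN0 : (0 : ℝ) < N := by exact_mod_cast hN
  -- The minimizer gets the norm `r` for which the regularizer contributes the curvature `μ`.
  set μ := L / (N : ℝ) ^ 2 with hμ
  have hμ0 : 0 < μ := by positivity
  set r := (μ / s) ^ (1 / (p - 2)) with hr
  have hr0 : 0 < r := by positivity
  have hrμ : s * r ^ (p - 2) = μ := by
    rw [hr, ← Real.rpow_mul (by positivity), one_div_mul_cancel hp2, Real.rpow_one]
    field_simp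
  have htarget1 : (L / (s ^ (2 / p) * (N : ℝ) ^ 2)) ^ (p / (p - 2)) = μ * r ^ 2 := by
    rw [mul_comm, ← div_div, ← hμ, hr, ← Real.rpow_natCast, ← Real.rpow_mul (by positivity)]
    refine div_rpow_rpow_eq hμ0 hs ?_ ?_
    · push_cast; field_simp
    · push_cast; field_simp; ring
  have htarget2 : (L / (s ^ (1 / (p - 1)) * (N : ℝ) ^ 2)) ^ ((p - 1) / (p - 2)) = μ * r := by
    rw [mul_comm, ← div_div, ← hμ, hr]
    refine div_rpow_rpow_eq hμ0 hs ?_ ?_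
    · field_simp
    · field_simp; ring
  obtain ⟨a, haL, hmax⟩ := exists_scale_isMaxEigenvalue (d := d) hL hN (by omega)
  have ha0 : 0 < a := by linarith
  set ε := μ / a with hε
  have hε0 : 0 ≤ ε := by positivity
  have hεN : ε ≤ 4 / (N : ℝ) ^ 2 := by
    rw [hε, hμ, div_div, div_le_div_iff₀ (by positivity) (by positivity)]
    nlinarith [mul_le_mul_of_nonneg_right haL (by positivity : 0 ≤ (N : ℝ) ^ 2)]
  -- The squared norm of the profile.
  set q := ∑ j ∈ Finset.range (N + 1), profile ε (N - j) ^ 2 with hq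
  have hqpos : 0 < q := by
    refine Finset.sum_pos (fun j _ => ?_) ⟨0, by simp⟩
    have := (profile_bounds hε0 (N - j)).1
    positivity
  have hqle : q ≤ (N + 1) * W ^ 2 := by
    calc q ≤ ∑ j ∈ Finset.range (N + 1), W ^ 2 := by
          refine Finset.sum_le_sum fun j _ => ?_
          have := (profile_bounds hε0 (N - j)).1
          exact pow_le_pow_left₀ (by linarith) (profile_le_exp hε0 hN hεN (Nat.sub_le N j)) 2
      _ = (N + 1) * W ^ 2 := by simp
  set ρ := r / Real.sqrt q with hρ
  have hρ2 : ρ ^ 2 * q = r ^ 2 := by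
    rw [hρ, div_pow, Real.sq_sqrt hqpos.le, div_mul_cancel₀ _ hqpos.ne']
  obtain ⟨u, hu, -, hux⟩ :=
    exists_resisting_family hp ha0.le (ρ * (μ * profileSum ε N)) N M N hd
  set b : E d := (ρ * (μ * profileSum ε N)) • u 0 with hb
  set A := pathMatrix a u N with hA
  have hApos : A.PosSemidef := posSemidef_pathMatrix ha0.le u N
  set y : E d := ρ • ∑ j ∈ Finset.range (N + 1), profile ε (N - j) • u j with hy
  have hynorm : ‖y‖ = r := by
    have h1 : ‖y‖ ^ 2 = r ^ 2 := by
      rw [hy, norm_smul, mul_pow, hu.norm_sum_smul_sq fun j => profile ε (N - j), Real.norm_eq_abs,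
        sq_abs, hρ2]
    exact (pow_left_inj₀ (norm_nonneg _) hr0.le two_ne_zero).1 h1
  have hcrit : objectiveGrad p s A b y = 0 := by
    have h := congrArg (fun v => (ρ * a) • v) (hu.pathLaplacian_profile ε)
    rw [objectiveGrad, hynorm, hrμ, hA, toEuclideanLin_pathMatrix, LinearMap.smul_apply, hy,
      map_smul, hb]
    have haε : a * ε = μ := by rw [hε]; field_simp
    have h' : μ • ρ • (∑ j ∈ Finset.range (N + 1), profile ε (N - j) • u j) =
        (ρ * a) • ε • ∑ j ∈ Finset.range (N + 1), profile ε (N - j) • u j := by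
      rw [← haε]; module
    have h'' : (ρ * (μ * profileSum ε N)) • u 0 = (ρ * a) • (ε * profileSum ε N) • u 0 := by
      rw [← haε]; module
    rw [h', h'', ← h]
    module
  set x := iterate M (objective p s A b) N with hx
  have hlast : ⟪u N, x - y⟫_ℝ ^ 2 = ρ ^ 2 := by
    rw [inner_sub_right, hux N le_rfl N le_rfl, hy, real_inner_smul_right,
      hu.inner_sum_smul (fun j => profile ε (N - j)) le_rfl, Nat.sub_self]
    simp [profile, profilePair]
  have henergy : μ * r ^ 2 / (16 * W ^ 2) ≤
      ⟪x - y, Matrix.toEuclideanLin A (x - y)⟫_ℝ + μ * ‖x - y‖ ^ 2 := by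
    have h := hu.energy_ge hN hL haL (x - y)
    rw [hlast, ← hμ] at h
    rw [hA, toEuclideanLin_pathMatrix, LinearMap.smul_apply, real_inner_smul_right]
    refine le_trans ?_ h
    rw [div_le_div_iff₀ (by positivity) (by norm_num), ← hρ2]
    have := mul_le_mul_of_nonneg_left hqle (by positivity : 0 ≤ μ * ρ ^ 2)
    nlinarith
  obtain ⟨hgap, hgrad⟩ := gap_and_gradient_ge hp hs (by positivity) hApos
    (hynorm.symm ▸ hrμ) hμ0 hcrit henergy
  refine ⟨A, b, y, hApos, hmax u hu, fun x' => ?_, ?_, ?_⟩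
  · have h := objective_sub_ge hp hs hApos b y x'
    rw [hcrit, inner_zero_left, sub_zero] at h
    have h0 := (Matrix.isPositive_toEuclideanLin_iff.2 hApos).2 (x' - y)
    rw [real_inner_comm] at h
    have h1 : 0 ≤ s * ‖y‖ ^ (p - 2) * ‖x' - y‖ ^ 2 := by positivity
    have h2 : 0 ≤ ⟪Matrix.toEuclideanLin A (x' - y), x' - y⟫_ℝ := h0
    linarith
  · rw [htarget1]
    refine le_trans (le_of_eq ?_) hgap
    field_simp
    norm_num
  · rw [htarget2, gradient_objective hp hApos]
    refine (pow_le_pow_iff_left₀ (by positivity) (norm_nonneg _) two_ne_zero).1 ?_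
    refine le_trans ?_ hgrad
    have hW2 : 1 ≤ W ^ 2 := one_le_pow₀ hW1
    have h1 : (1 / (32 * W ^ 2) * (μ * r)) ^ 2 = μ ^ 2 * r ^ 2 / (1024 * W ^ 2 * W ^ 2) := by
      field_simp; norm_num
    have h2 : μ * (μ * r ^ 2 / (16 * W ^ 2)) / 4 = μ ^ 2 * r ^ 2 / (64 * W ^ 2) := by
      field_simp; norm_num
    rw [h1, h2]
    refine div_le_div_of_nonneg_left (by positivity) (by positivity) ?_
    nlinarith
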